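/- Let $\Gamma$ be a finite simple graph with vertex set $S$, and let $G(\Gamma)$ be the right-angled Artin group of $\Gamma$, that is, the group with one generator $x_s$ for each $s \in S$ and one relator $[x_s, x_t] = x_s^{-1}x_t^{-1}x_sx_t$ for each edge $\{s,t\}$ of $\Gamma$. (1) For each $s \in S$ let $X_s$ be a $2$-ended group, i.e. a finitely generated group whose Cayley graph with respect to some (equivalently, every) finite generating set has exactly two ends. Let $$G_\Gamma(\mathbf X) = \Big(\mathop{\ast}_{s \in S} X_s\Big) \Big/ \langle\!\langle\, [X_s, X_t] : s,t \in S,\ \{s,t\} \in E(\Gamma) \,\rangle\!\rangle$$ be the graph product of the groups $(X_s)_{s\in S}$ over $\Gamma$. Then $G_\Gamma(\mathbf X)$ is abstractly commensurable with $G(\Gamma)$, i.e. these two groups have isomorphic subgroups of finite index. (2) Consequently, $G(\Gamma)$ is abstractly commensurable with a right-angled Coxeter group of finite rank, i.e. with a Coxeter group on a finite generating set whose Coxeter matrix has all off-diagonal entries in $\{2, \infty\}$. -/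

import Mathlib

universe u v

/-- A group is *2-ended* if it is finitely generated and its Cayley graph with respect to a finite
generating set has exactly two ends. The number of ends does not depend on the choice of the
finite generating set, so it is enough to ask for one such set. -/
def IsTwoEnded (X : Type*) [Group X] : Prop :=
  ∃ A : Set X, A.Finite ∧ Subgroup.closure A = ⊤ ∧ (SimpleGraph.mulCayley A).end.encard = 2

/-- Two groups are *abstractly commensurable* if they have isomorphic subgroups of finite index. -/
def AbstractlyCommensurable (G H : Type*) [Group G] [Group H] : Prop :=
  ∃ (A : Subgroup G) (B : Subgroup H), A.FiniteIndex ∧ B.FiniteIndex ∧ Nonempty (A ≃* B)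

/-- The commutators `[x, y] = x⁻¹ y⁻¹ x y` with `x ∈ X s` and `y ∈ X t` for `s`, `t` adjacent in `Γ`,
inside the free product of the groups `X s`. -/
def graphProductRels {S : Type*} (Γ : SimpleGraph S) (X : S → Type*) [∀ s, Group (X s)] :
    Set (Monoid.CoprodI X) :=
  {r | ∃ s t : S, Γ.Adj s t ∧ ∃ (x : X s) (y : X t),
    r = (Monoid.CoprodI.of x)⁻¹ * (Monoid.CoprodI.of y)⁻¹ *
      Monoid.CoprodI.of x * Monoid.CoprodI.of y}

/-- The graph product over `Γ` of the groups `X s`: the quotient of their free product by the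
normal closure of all `[X s, X t]` with `s`, `t` adjacent in `Γ`. -/
abbrev GraphProduct {S : Type*} (Γ : SimpleGraph S) (X : S → Type*) [∀ s, Group (X s)] : Type _ :=
  Monoid.CoprodI X ⧸ Subgroup.normalClosure (graphProductRels Γ X)

/-- The defining relators `xₛ⁻¹ xₜ⁻¹ xₛ xₜ` of the right-angled Artin group of `Γ`, one for each
pair of adjacent vertices. -/
def raagRels {S : Type*} (Γ : SimpleGraph S) : Set (FreeGroup S) :=
  {r | ∃ s t : S, Γ.Adj s t ∧
    r = (FreeGroup.of s)⁻¹ * (FreeGroup.of t)⁻¹ * FreeGroup.of s * FreeGroup.of t}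

/-- The right-angled Artin group of `Γ`. -/
abbrev RAAG {S : Type*} (Γ : SimpleGraph S) : Type _ := PresentedGroup (raagRels Γ)

/-- A Coxeter matrix is *right-angled* if all its off-diagonal entries are `2` or `∞`
(in Mathlib, the entry `0` stands for `∞`, that is, for the absence of a relation). -/
def IsRightAngled {T : Type*} (M : CoxeterMatrix T) : Prop :=
  ∀ i j : T, i ≠ j → M i j = 2 ∨ M i j = 0

/-! Suppose that at each vertex `s` the groups `X s` and `Y s` have isomorphic subgroups of the same
finite index. Both coset spaces can then be identified with one finite set `F s`, and the
isomorphism yields mutually inverse cocycles `X s × F s → Y s` and `Y s × F s → X s`: each element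
is traded, point by point, for one of the other group that moves the point in the same way. Such
cocycles extend to the graph products acting on `∀ s, F s`, because elements at adjacent vertices
touch different coordinates and commute. Mutually inverse cocycles restrict to isomorphisms of point
stabilizers, which have finite index. This is `GraphProduct.abstractlyCommensurable`.

The equal-index condition is free against `ℤ`, which has infinite cyclic subgroups of every positive
index. So graph products of virtually infinite cyclic groups are commensurable with the graph
product of copies of `ℤ`, the right-angled Artin group. With infinite dihedral vertex groups the
graph product is a right-angled Coxeter group, which gives the second claim.

That 2-ended groups are virtually `ℤ` (`IsTwoEnded.isVirtuallyInfiniteCyclic`) is shown in the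
Cayley graph. Take an infinite, co-infinite `E` with finite coboundary. Having only two ends forces
every translate of `E` to be almost equal to `E` or `Eᶜ`, so the almost stabilizer of `E` has finite
index. Counting how far `g` shifts `E` is a homomorphism to `ℤ`. Its kernel is finite, since a
translate that moves the coboundary off itself is properly nested with `E`. -/

open Equiv (Perm)

/-! ### Universal property of graph products -/

namespace GraphProduct

variable {S : Type u} {Γ : SimpleGraph S} {X : S → Type v} [∀ s, Group (X s)]

/-- The canonical homomorphism of a vertex group into the graph product. -/
def of (s : S) : X s →* GraphProduct Γ X :=
  (QuotientGroup.mk' _).comp Monoid.CoprodI.of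

theorem of_mul_of_comm {s t : S} (h : Γ.Adj s t) (x : X s) (y : X t) :
    (of s x : GraphProduct Γ X) * of t y = of t y * of s x := by
  have h1 : (QuotientGroup.mk' (Subgroup.normalClosure (graphProductRels Γ X)))
      ((Monoid.CoprodI.of x)⁻¹ * (Monoid.CoprodI.of y)⁻¹ *
        Monoid.CoprodI.of x * Monoid.CoprodI.of y) = 1 :=
    (QuotientGroup.eq_one_iff _).mpr (Subgroup.subset_normalClosure ⟨s, t, h, x, y, rfl⟩)
  simp only [map_mul, map_inv] at h1
  have h2 : (of s x : GraphProduct Γ X)⁻¹ * (of t y)⁻¹ * of s x * of t y = 1 := h1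
  rw [mul_assoc, ← mul_inv_rev, inv_mul_eq_one] at h2
  exact h2.symm

/-- The universal property of the graph product. -/
def lift {N : Type*} [Group N] (f : ∀ s, X s →* N)
    (h : ∀ s t, Γ.Adj s t → ∀ x y, f s x * f t y = f t y * f s x) : GraphProduct Γ X →* N :=
  QuotientGroup.lift _ (Monoid.CoprodI.lift f) <| by
    have : Subgroup.normalClosure (graphProductRels Γ X) ≤ (Monoid.CoprodI.lift f).ker := by
      refine Subgroup.normalClosure_le_normal ?_
      rintro _ ⟨s, t, hst, x, y, rfl⟩
      have := h s t hst x y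
      simp only [SetLike.mem_coe, MonoidHom.mem_ker, map_mul, map_inv, Monoid.CoprodI.lift_of]
      rw [mul_assoc, this, ← mul_inv_rev, inv_mul_cancel]
    exact this

@[simp]
theorem lift_of {N : Type*} [Group N] (f : ∀ s, X s →* N)
    (h : ∀ s t, Γ.Adj s t → ∀ x y, f s x * f t y = f t y * f s x) (s : S) (x : X s) :
    lift f h (of s x) = f s x :=
  Monoid.CoprodI.lift_of f x

@[elab_as_elim]
theorem induction_on {C : GraphProduct Γ X → Prop} (g : GraphProduct Γ X) (one : C 1)
    (of : ∀ s x, C (of s x)) (mul : ∀ a b, C a → C b → C (a * b)) : C g := by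
  obtain ⟨g, rfl⟩ := QuotientGroup.mk_surjective g
  induction g using Monoid.CoprodI.induction_on with
  | one => exact one
  | of s x => exact of s x
  | mul a b ha hb => exact mul _ _ ha hb

theorem hom_ext {N : Type*} [Group N] {f g : GraphProduct Γ X →* N}
    (h : ∀ s x, f (of s x) = g (of s x)) : f = g := by
  refine MonoidHom.ext fun a => ?_
  induction a using induction_on with
  | one => simp
  | of s x => exact h s x
  | mul a b ha hb => rw [map_mul, map_mul, ha, hb]

end GraphProduct

/-! ### Orbit cocycles and point stabilizers -/

/-- The permutation representation given by an action map. -/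
def permHomOfAction {G α : Type*} [Group G] (f : G → α → α) (one : ∀ a, f 1 a = a)
    (mul : ∀ g h a, f (g * h) a = f g (f h a)) : G →* Perm α where
  toFun g := ⟨f g, f g⁻¹, fun a => by rw [← mul, inv_mul_cancel, one],
    fun a => by rw [← mul, mul_inv_cancel, one]⟩
  map_one' := Equiv.ext one
  map_mul' g h := Equiv.ext (mul g h)

theorem permHomOfAction_apply {G α : Type*} [Group G] (f : G → α → α) (one : ∀ a, f 1 a = a)
    (mul : ∀ g h a, f (g * h) a = f g (f h a)) (g : G) (a : α) :
    permHomOfAction f one mul g a = f g a := rfl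

/-- Given actions `π` of `G` and `π'` of `H` on `F`, a map `G × F → H` satisfying the cocycle
identity and moving every point in the same way as `G` does. -/
structure OrbitCocycle {G H F : Type*} [Group G] [Group H] (π : G →* Perm F) (π' : H →* Perm F)
    where
  toFun : G → F → H
  map_mul' : ∀ g g' p, toFun (g * g') p = toFun g (π g' p) * toFun g' p
  perm_apply' : ∀ g p, π' (toFun g p) p = π g p

theorem Subgroup.finiteIndex_comap {G H : Type*} [Group G] [Group H] (K : Subgroup H)
    [K.FiniteIndex] (f : G →* H) : (K.comap f).FiniteIndex :=
  ⟨by rw [Subgroup.index_comap]; exact Subgroup.FiniteIndex.index_ne_zero⟩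

namespace OrbitCocycle

section Basic

variable {G H F : Type*} [Group G] [Group H] {π : G →* Perm F} {π' : H →* Perm F}

instance : CoeFun (OrbitCocycle π π') fun _ => G → F → H := ⟨toFun⟩

variable (φ : OrbitCocycle π π') (ψ : OrbitCocycle π' π)

theorem map_mul (g g' : G) (p : F) : φ (g * g') p = φ g (π g' p) * φ g' p := φ.map_mul' g g' p

theorem perm_apply (g : G) (p : F) : π' (φ g p) p = π g p := φ.perm_apply' g p

theorem map_one (p : F) : φ 1 p = 1 := by
  have := φ.map_mul 1 1 p
  simpa using this

/-- `ψ` undoes `φ`. -/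
def IsLeftInverse : Prop := ∀ g p, ψ (φ g p) p = g

/-- The homomorphism between point stabilizers given by a cocycle. -/
def stabilizerHom (p : F) :
    (MulAction.stabilizer (Perm F) p).comap π →* (MulAction.stabilizer (Perm F) p).comap π' where
  toFun g := ⟨φ g p, by
    have : π g p = p := g.2
    rw [Subgroup.mem_comap, MulAction.mem_stabilizer_iff, Perm.smul_def, φ.perm_apply, this]⟩
  map_one' := Subtype.ext (φ.map_one p)
  map_mul' g g' := Subtype.ext <| by
    have : π g' p = p := g'.2
    change φ (g * g') p = φ g p * φ g' p
    rw [φ.map_mul, this]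

/-- Mutually inverse cocycles give isomorphisms between point stabilizers. -/
def stabilizerEquiv (h : IsLeftInverse φ ψ) (h' : IsLeftInverse ψ φ) (p : F) :
    (MulAction.stabilizer (Perm F) p).comap π ≃* (MulAction.stabilizer (Perm F) p).comap π' :=
  MonoidHom.toMulEquiv (φ.stabilizerHom p) (ψ.stabilizerHom p)
    (MonoidHom.ext fun g => Subtype.ext (h g p)) (MonoidHom.ext fun g => Subtype.ext (h' g p))

theorem abstractlyCommensurable [Finite F] [Nonempty F] (h : IsLeftInverse φ ψ)
    (h' : IsLeftInverse ψ φ) : AbstractlyCommensurable G H := by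
  obtain ⟨p⟩ := ‹Nonempty F›
  exact ⟨_, _, Subgroup.finiteIndex_comap _ π, Subgroup.finiteIndex_comap _ π', ⟨stabilizerEquiv φ ψ h h' p⟩⟩

end Basic

/-! ### Extending cocycles from vertex groups to graph products -/

section GraphProduct

universe w x

variable {S : Type u} [DecidableEq S] {Γ : SimpleGraph S} {X : S → Type v} [∀ s, Group (X s)]
  {Y : S → Type w} [∀ s, Group (Y s)] {F : S → Type x}

variable (Γ) in
/-- The coordinatewise action of a graph product on a product of sets with actions of the vertex
groups. -/
def graphProductPerm (π : ∀ s, X s →* Perm (F s)) : GraphProduct Γ X →* Perm (∀ s, F s) :=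
  GraphProduct.lift
    (fun s => permHomOfAction (fun x ω => Function.update ω s (π s x (ω s)))
      (by simp) (by simp))
    (by
      intro s t hst x y
      have hne : s ≠ t := hst.ne
      refine Equiv.ext fun ω => ?_
      change Function.update (Function.update ω t _) s (π s x (Function.update ω t _ s)) =
        Function.update (Function.update ω s _) t (π t y (Function.update ω s _ t))
      rw [Function.update_of_ne hne, Function.update_of_ne hne.symm, Function.update_comm hne])

theorem graphProductPerm_of (π : ∀ s, X s →* Perm (F s)) (s : S) (x : X s) (ω : ∀ s, F s) :
    graphProductPerm Γ π (GraphProduct.of s x) ω = Function.update ω s (π s x (ω s)) := by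
  rw [graphProductPerm, GraphProduct.lift_of, permHomOfAction_apply]

variable {π : ∀ s, X s →* Perm (F s)} {π' : ∀ s, Y s →* Perm (F s)}

variable (Γ) in
/-- The action of the graph product of the `X s` on the product of `∀ s, F s` and the graph product
of the `Y s` which is induced by cocycles at the vertices. -/
def skewPerm (φ : ∀ s, OrbitCocycle (π s) (π' s)) :
    GraphProduct Γ X →* Perm ((∀ s, F s) × GraphProduct Γ Y) :=
  GraphProduct.lift
    (fun s => permHomOfAction
      (fun x q => (Function.update q.1 s (π s x (q.1 s)), GraphProduct.of s (φ s x (q.1 s)) * q.2))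
      (by simp [map_one]) (by simp [map_mul, mul_assoc]))
    (by
      intro s t hst x y
      -- The cocycle at `s` sees only coordinate `s`, which the update at `t` leaves alone; the two
      -- elements multiplied on the left commute by adjacency.
      have hne : s ≠ t := hst.ne
      refine Equiv.ext fun q => ?_
      change (Function.update (Function.update q.1 t _) s (π s x (Function.update q.1 t _ s)),
          GraphProduct.of s (φ s x (Function.update q.1 t _ s)) *
            (GraphProduct.of t (φ t y (q.1 t)) * q.2)) =
        (Function.update (Function.update q.1 s _) t (π t y (Function.update q.1 s _ t)),
          GraphProduct.of t (φ t y (Function.update q.1 s _ t)) *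
            (GraphProduct.of s (φ s x (q.1 s)) * q.2))
      rw [Function.update_of_ne hne, Function.update_of_ne hne.symm, Function.update_comm hne,
        ← mul_assoc, ← mul_assoc, GraphProduct.of_mul_of_comm hst])

variable (φ : ∀ s, OrbitCocycle (π s) (π' s)) (ψ : ∀ s, OrbitCocycle (π' s) (π s))

theorem skewPerm_of (s : S) (x : X s) (ω : ∀ s, F s) (k : GraphProduct Γ Y) :
    skewPerm Γ φ (GraphProduct.of s x) (ω, k) =
      (Function.update ω s (π s x (ω s)), GraphProduct.of s (φ s x (ω s)) * k) := by
  rw [skewPerm, GraphProduct.lift_of, permHomOfAction_apply]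

/-- The skew action commutes with right multiplication on the second factor, so its values at `(ω,
1)` determine it. The cocycle identity for these values follows. -/
theorem skewPerm_apply (g : GraphProduct Γ X) (ω : ∀ s, F s) (k : GraphProduct Γ Y) :
    skewPerm Γ φ g (ω, k) = (graphProductPerm Γ π g ω, (skewPerm Γ φ g (ω, 1)).2 * k) := by
  induction g using GraphProduct.induction_on generalizing ω k with
  | one => simp
  | of s x => simp [skewPerm_of, graphProductPerm_of]
  | mul a b ha hb =>
    simp only [_root_.map_mul, Perm.mul_apply]
    rw [hb, ha, hb ω 1, ha _ (_ * 1)]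
    simp [mul_assoc]

/-- Cocycles at the vertices induce a cocycle between graph products. -/
def graphProduct : OrbitCocycle (graphProductPerm Γ π) (graphProductPerm Γ π') where
  toFun g ω := (skewPerm Γ φ g (ω, 1)).2
  map_mul' g g' ω := by
    rw [_root_.map_mul, Perm.mul_apply, skewPerm_apply φ g' ω, skewPerm_apply φ g]
  perm_apply' g ω := by
    induction g using GraphProduct.induction_on generalizing ω with
    | one => simp
    | of s x => simp [skewPerm_of, graphProductPerm_of, perm_apply]
    | mul a b ha hb =>
      rw [_root_.map_mul, Perm.mul_apply, skewPerm_apply φ b ω, skewPerm_apply φ a]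
      simp [ha, hb]

theorem graphProduct_of (s : S) (x : X s) (ω : ∀ s, F s) :
    graphProduct (Γ := Γ) φ (GraphProduct.of s x) ω = GraphProduct.of s (φ s x (ω s)) := by
  change (skewPerm Γ φ _ (ω, 1)).2 = _
  simp [skewPerm_of]

theorem graphProduct_isLeftInverse (h : ∀ s, IsLeftInverse (φ s) (ψ s)) :
    IsLeftInverse (graphProduct (Γ := Γ) φ) (graphProduct (Γ := Γ) ψ) := by
  intro g ω
  induction g using GraphProduct.induction_on generalizing ω with
  | one => rw [map_one, map_one]
  | of s x => rw [graphProduct_of, graphProduct_of, h]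
  | mul a b ha hb => rw [map_mul, map_mul, perm_apply, ha, hb]

end GraphProduct

/-! ### Cocycles from isomorphic subgroups of equal index -/

section Coset

variable {X Y F : Type*} [Group X] [Group Y] {A : Subgroup X} {B : Subgroup Y}

/-- The action on cosets, transported along a bijection. -/
def cosetPerm (α : F ≃ X ⧸ A) : X →* Perm F :=
  α.symm.permCongrHom.toMonoidHom.comp (MulAction.toPermHom X (X ⧸ A))

theorem cosetPerm_apply (α : F ≃ X ⧸ A) (x : X) (p : F) : cosetPerm α x p = α.symm (x • α p) := rfl

/-- The element of `A` by which `x` moves the representative of the coset `α p`. -/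
noncomputable def cosetShift (α : F ≃ X ⧸ A) (x : X) (p : F) : A :=
  ⟨(α (cosetPerm α x p)).out⁻¹ * x * (α p).out, by
    rw [mul_assoc, ← QuotientGroup.eq, QuotientGroup.out_eq', cosetPerm_apply,
      Equiv.apply_symm_apply]
    conv_lhs => rw [← QuotientGroup.out_eq' (α p)]
    rfl⟩

theorem coe_cosetShift (α : F ≃ X ⧸ A) (x : X) (p : F) :
    (cosetShift α x p : X) = (α (cosetPerm α x p)).out⁻¹ * x * (α p).out := rfl

theorem cosetShift_mul (α : F ≃ X ⧸ A) (x y : X) (p : F) :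
    cosetShift α (x * y) p = cosetShift α x (cosetPerm α y p) * cosetShift α y p := by
  ext
  simp [coe_cosetShift, mul_assoc]

/-- An isomorphism between subgroups and a bijection between their cosets induce a cocycle. -/
noncomputable def ofCosets (α : F ≃ X ⧸ A) (β : F ≃ Y ⧸ B) (θ : A ≃* B) :
    OrbitCocycle (cosetPerm α) (cosetPerm β) where
  -- `x` is representative · shift · representative⁻¹; the representatives are replaced by those in
  -- `Y` and the shift by its image under `θ`.
  toFun x p := (β (cosetPerm α x p)).out * θ (cosetShift α x p) * (β p).out⁻¹
  map_mul' x y p := by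
    rw [cosetShift_mul]
    simp [mul_assoc]
  perm_apply' x p := by
    rw [cosetPerm_apply β, Equiv.symm_apply_eq]
    generalize cosetShift α x p = a
    generalize cosetPerm α x p = q
    conv_lhs => rw [← QuotientGroup.out_eq' (β p)]
    conv_rhs => rw [← QuotientGroup.out_eq' (β q)]
    rw [MulAction.Quotient.smul_mk, QuotientGroup.eq]
    simp

theorem ofCosets_apply (α : F ≃ X ⧸ A) (β : F ≃ Y ⧸ B) (θ : A ≃* B) (x : X) (p : F) :
    ofCosets α β θ x p =
      (β (cosetPerm α x p)).out * θ (cosetShift α x p) * (β p).out⁻¹ := rfl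

theorem ofCosets_isLeftInverse (α : F ≃ X ⧸ A) (β : F ≃ Y ⧸ B) (θ : A ≃* B) :
    IsLeftInverse (ofCosets α β θ) (ofCosets β α θ.symm) := by
  intro x p
  have h : cosetShift β (ofCosets α β θ x p) p = θ (cosetShift α x p) := by
    ext
    rw [coe_cosetShift, perm_apply, ofCosets_apply]
    simp [mul_assoc]
  rw [ofCosets_apply β α, h, perm_apply]
  simp [coe_cosetShift, mul_assoc]

end Coset

end OrbitCocycle

/-- Graph products over a finite graph are abstractly commensurable if corresponding vertex groups
have isomorphic subgroups of the same finite index. -/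
theorem GraphProduct.abstractlyCommensurable {S : Type u} [Finite S] (Γ : SimpleGraph S)
    {X : S → Type*} [∀ s, Group (X s)] {Y : S → Type*} [∀ s, Group (Y s)]
    (h : ∀ s, ∃ (A : Subgroup (X s)) (B : Subgroup (Y s)), A.index ≠ 0 ∧ A.index = B.index ∧
      Nonempty (A ≃* B)) :
    AbstractlyCommensurable (GraphProduct Γ X) (GraphProduct Γ Y) := by
  classical
  choose A B hA hAB θ using h
  have hα (s : S) : Nonempty (Fin (A s).index ≃ X s ⧸ A s) :=
    have : (A s).FiniteIndex := ⟨hA s⟩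
    ⟨(Finite.equivFinOfCardEq rfl).symm⟩
  have hβ (s : S) : Nonempty (Fin (A s).index ≃ Y s ⧸ B s) :=
    have : (B s).FiniteIndex := ⟨hAB s ▸ hA s⟩
    ⟨(Finite.equivFinOfCardEq (hAB s).symm).symm⟩
  have hne (s : S) : Nonempty (Fin (A s).index) := ⟨⟨0, Nat.pos_of_ne_zero (hA s)⟩⟩
  let α s := (hα s).some
  let φ s := OrbitCocycle.ofCosets (α s) (hβ s).some (θ s).some
  let ψ s := OrbitCocycle.ofCosets (hβ s).some (α s) (θ s).some.symm
  exact OrbitCocycle.abstractlyCommensurable (OrbitCocycle.graphProduct φ)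
    (OrbitCocycle.graphProduct ψ)
    (OrbitCocycle.graphProduct_isLeftInverse φ ψ fun s => OrbitCocycle.ofCosets_isLeftInverse _ _ _)
    (OrbitCocycle.graphProduct_isLeftInverse ψ φ fun s => OrbitCocycle.ofCosets_isLeftInverse _ _ _)

/-! ### Ends of graphs and sets with finite coboundary -/

open Pointwise Opposite Filter

/-- The six hypotheses say that the union of any two of the four quadrants is infinite, so at most
one quadrant is finite. -/
theorem Set.three_infinite_of_symmDiff_infinite {α : Type*} {E F : Set α} (hE : E.Infinite)
    (hE' : Eᶜ.Infinite) (hF : F.Infinite) (hF' : Fᶜ.Infinite) (h : (symmDiff F E).Infinite)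
    (h' : (symmDiff F Eᶜ).Infinite) :
    ((F ∩ E).Infinite ∧ (F ∩ Eᶜ).Infinite ∧ (Fᶜ ∩ E).Infinite) ∨
    ((F ∩ E).Infinite ∧ (F ∩ Eᶜ).Infinite ∧ (Fᶜ ∩ Eᶜ).Infinite) ∨
    ((F ∩ E).Infinite ∧ (Fᶜ ∩ E).Infinite ∧ (Fᶜ ∩ Eᶜ).Infinite) ∨
    ((F ∩ Eᶜ).Infinite ∧ (Fᶜ ∩ E).Infinite ∧ (Fᶜ ∩ Eᶜ).Infinite) := by
  rw [← Set.inter_union_compl E F, Set.infinite_union, Set.inter_comm E, Set.inter_comm E] at hE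
  rw [← Set.inter_union_compl Eᶜ F, Set.infinite_union, Set.inter_comm Eᶜ,
    Set.inter_comm Eᶜ] at hE'
  rw [← Set.inter_union_compl F E, Set.infinite_union] at hF
  rw [← Set.inter_union_compl Fᶜ E, Set.infinite_union] at hF'
  rw [Set.symmDiff_def, Set.infinite_union, Set.sdiff_eq, Set.sdiff_eq, Set.inter_comm E] at h
  rw [Set.symmDiff_def, Set.infinite_union, Set.sdiff_eq, Set.sdiff_eq, compl_compl,
    Set.inter_comm Eᶜ] at h'
  generalize (F ∩ E).Infinite = a at *
  generalize (F ∩ Eᶜ).Infinite = b at *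
  generalize (Fᶜ ∩ E).Infinite = c at *
  generalize (Fᶜ ∩ Eᶜ).Infinite = d at *
  tauto

namespace SimpleGraph

variable {V : Type u} {G : SimpleGraph V} {E F K L P : Set V}

/-- Every edge of `G` that leaves `E` has both its endpoints in `K`. -/
def CoboundaryIn (G : SimpleGraph V) (E K : Set V) : Prop :=
  ∀ ⦃v w⦄, G.Adj v w → v ∈ E → w ∉ E → v ∈ K ∧ w ∈ K

namespace CoboundaryIn

theorem mono (h : G.CoboundaryIn E K) (hKL : K ⊆ L) : G.CoboundaryIn E L :=
  fun _ _ hvw hv hw => ⟨hKL (h hvw hv hw).1, hKL (h hvw hv hw).2⟩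

theorem compl (h : G.CoboundaryIn E K) : G.CoboundaryIn Eᶜ K :=
  fun _ _ hvw hv hw => (h hvw.symm (not_not.1 hw) hv).symm

theorem inter (hE : G.CoboundaryIn E K) (hF : G.CoboundaryIn F K) :
    G.CoboundaryIn (E ∩ F) K := by
  intro v w hvw hv hw
  by_cases h : w ∈ E
  · exact hF hvw hv.2 fun h' => hw ⟨h, h'⟩
  · exact hE hvw hv.1 h

theorem subset_or_subset_compl (hE : G.CoboundaryIn E K) (hL : (G.induce L).Preconnected)
    (hKL : Disjoint K L) : L ⊆ E ∨ L ⊆ Eᶜ := by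
  by_contra! h
  obtain ⟨⟨v, hvL, hv⟩, w, hwL, hw⟩ := And.imp Set.not_subset.1 Set.not_subset.1 h
  obtain ⟨p⟩ := hL ⟨w, hwL⟩ ⟨v, hvL⟩
  obtain ⟨d, -, h1, h2⟩ := p.exists_boundary_dart (Subtype.val ⁻¹' E) (not_not.1 hw) hv
  exact Set.disjoint_left.1 hKL (hE d.adj h1 h2).1 d.fst.2

/-- A path from a point of `Eᶜ \ P` to `K` must leave `Eᶜ \ P`. Entering `E` would put the edge in
`K ⊆ P`, and entering `P` would put it in `L ⊆ E`; both are absurd. -/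
theorem compl_subset (hE : G.CoboundaryIn E K) (hP : G.CoboundaryIn P L) (hG : G.Preconnected)
    (hK : K.Nonempty) (hLE : L ⊆ E) (hKP : K ⊆ P) : Eᶜ ⊆ P := by
  intro v hv
  by_contra hvP
  obtain ⟨k, hk⟩ := hK
  obtain ⟨p⟩ := hG v k
  obtain ⟨d, -, h1, h2⟩ := p.exists_boundary_dart (Eᶜ \ P) ⟨hv, hvP⟩ fun h => h.2 (hKP hk)
  have h3 : d.snd ∉ E := fun h => h1.2 (hKP (hE d.adj.symm h h1.1).2)
  have h4 : d.snd ∈ P := by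
    by_contra h
    exact h2 ⟨h3, h⟩
  exact h1.1 (hLE (hP d.adj.symm h4 h1.2).2)

theorem inter_nonempty (hE : G.CoboundaryIn E K) (hG : G.Preconnected) (h : E.Nonempty)
    (h' : Eᶜ.Nonempty) : (E ∩ K).Nonempty ∧ (Eᶜ ∩ K).Nonempty := by
  obtain ⟨v, hv⟩ := h
  obtain ⟨w, hw⟩ := h'
  obtain ⟨p⟩ := hG v w
  obtain ⟨d, -, h1, h2⟩ := p.exists_boundary_dart E hv hw
  have := hE d.adj h1 h2
  exact ⟨⟨_, h1, this.1⟩, ⟨_, h2, this.2⟩⟩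

/-- Two almost equal, infinite and co-infinite sets whose coboundaries lie in disjoint connected
sets are properly nested. -/
theorem ssubset_or_ssubset (hE : G.CoboundaryIn E K) (hP : G.CoboundaryIn P L)
    (hG : G.Preconnected) (hKc : (G.induce K).Preconnected) (hLc : (G.induce L).Preconnected)
    (hKL : Disjoint K L) (hEi : E.Infinite) (hEi' : Eᶜ.Infinite)
    (h : (E \ P).Finite) (h' : (P \ E).Finite) : P ⊂ E ∨ E ⊂ P := by
  obtain ⟨⟨a, haE, haK⟩, b, hbE, hbK⟩ := hE.inter_nonempty hG hEi.nonempty hEi'.nonempty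
  -- Of the four positions, two give nesting; the other two put all of `Eᶜ` in `P \ E` or all of `E`
  -- in `E \ P`, against almost equality.
  rcases hE.subset_or_subset_compl hLc hKL with h1 | h1 <;>
  rcases hP.subset_or_subset_compl hKc hKL.symm with h2 | h2
  · refine absurd (h'.subset fun x hx => ⟨?_, hx⟩) hEi'
    exact hE.compl_subset hP hG ⟨a, haK⟩ h1 h2 hx
  · have h3 := hE.compl_subset hP.compl hG ⟨a, haK⟩ h1 h2
    exact .inl ⟨Set.compl_subset_compl.1 h3, fun h4 => h2 haK (h4 haE)⟩
  · have h3 := hE.compl.compl_subset hP hG ⟨a, haK⟩ h1 h2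
    rw [compl_compl] at h3
    exact .inr ⟨h3, fun h4 => hbE (h4 (h2 hbK))⟩
  · have h3 := hE.compl.compl_subset hP.compl hG ⟨a, haK⟩ h1 h2
    rw [compl_compl] at h3
    exact absurd (h.subset fun x hx => ⟨hx, h3 hx⟩) hEi

end CoboundaryIn

theorem ComponentCompl.exists_coboundaryIn [G.LocallyFinite] {K : Finset V}
    (C : G.ComponentCompl (K : Set V)) : ∃ L : Finset V, G.CoboundaryIn C.supp L := by
  classical
  refine ⟨K ∪ K.biUnion fun v => G.neighborFinset v, fun v w hvw hv hw => ?_⟩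
  have hwK : w ∈ K := by
    by_contra h
    exact hw (ComponentCompl.mem_of_adj v w hv h hvw)
  simp only [Finset.coe_union, Finset.coe_biUnion, Set.mem_union, Finset.mem_coe, Set.mem_iUnion,
    mem_neighborFinset]
  exact ⟨.inr ⟨w, hwK, hvw.symm⟩, .inl hwK⟩

/-- A non-principal ultrafilter on the vertices of a connected locally finite graph determines an
end of the graph. -/
theorem exists_end_of_ultrafilter [G.LocallyFinite] (hG : G.Preconnected) (U : Ultrafilter V)
    (hU : (U : Filter V) ≤ cofinite) : ∃ e ∈ G.end, ∀ K, (e K).supp ∈ U := by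
  have : Fact G.Preconnected := ⟨hG⟩
  have h (K : Finset V) : ∃ C : G.ComponentCompl (K : Set V), C.supp ∈ U := by
    have hK : (⋃ C ∈ (Set.univ : Set (G.ComponentCompl (K : Set V))), C.supp) ∈ U := by
      -- Off the finite set `K` there are finitely many components, so the ultrafilter selects one.
      refine mem_of_superset (hU K.finite_toSet.compl_mem_cofinite) fun v hv => ?_
      exact Set.mem_biUnion (Set.mem_univ (G.componentComplMk hv)) (G.componentComplMk_mem hv)
    obtain ⟨C, -, hC⟩ := (Ultrafilter.finite_biUnion_mem_iff Set.finite_univ).1 hK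
    exact ⟨C, hC⟩
  choose e he using h
  refine ⟨fun K => e K.unop, fun {L K} f => ?_, fun K => he K.unop⟩
  refine (ComponentCompl.hom_eq_iff_not_disjoint _ (CategoryTheory.le_of_op_hom f) _).2 fun hd => ?_
  have := inter_mem (he L.unop) (he K.unop)
  have h0 : (e L.unop).supp ∩ (e K.unop).supp = ∅ := hd.inter_eq
  rw [h0] at this
  exact U.empty_notMem this

/-- An ultrafilter containing `E` and all cofinite sets picks components that meet `E`; once the
coboundary is removed, a component meeting `E` cannot leave it. -/
theorem exists_end_of_infinite [G.LocallyFinite] (hG : G.Preconnected) (hE : E.Infinite)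
    {K : Finset V} (hEK : G.CoboundaryIn E K) :
    ∃ e ∈ G.end, ∀ L : Finset V, K ⊆ L → (e (op L)).supp ⊆ E := by
  have hne : NeBot (cofinite ⊓ 𝓟 E) := hE.cofinite_inf_principal_neBot
  obtain ⟨e, he, heU⟩ := exists_end_of_ultrafilter hG (Ultrafilter.of (cofinite ⊓ 𝓟 E))
    ((Ultrafilter.of_le _).trans inf_le_left)
  refine ⟨e, he, fun L hKL => ?_⟩
  have hEU : E ∈ Ultrafilter.of (cofinite ⊓ 𝓟 E) :=
    ((Ultrafilter.of_le _).trans inf_le_right) (mem_principal_self E)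
  obtain ⟨v, hv, hvE⟩ := (Ultrafilter.of (cofinite ⊓ 𝓟 E)).nonempty_of_mem
    (inter_mem (heU (op L)) hEU)
  intro w hw
  obtain ⟨hvL, hvC⟩ := hv
  obtain ⟨hwL, hwC⟩ := hw
  obtain ⟨p⟩ := ConnectedComponent.exact (hvC.trans hwC.symm)
  by_contra hwE
  obtain ⟨d, -, h1, h2⟩ := p.exists_boundary_dart (Subtype.val ⁻¹' E) hvE hwE
  exact d.fst.2 (hKL (hEK d.adj h1 h2).1)

theorem infinite_supp_of_mem_end {e : ∀ K, G.componentComplFunctor.obj K} (he : e ∈ G.end)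
    (K : (Finset V)ᵒᵖ) : (e K).supp.Infinite :=
  (e K).infinite_iff_in_all_ranges.2 fun L h =>
    ⟨e (op L), he (CategoryTheory.opHomOfLE (x := K) (y := op L) h)⟩

theorem exists_infinite_of_two_ends [G.LocallyFinite] (hG : G.Preconnected)
    (h2 : G.end.encard = 2) : ∃ (E : Set V) (K : Finset V), G.CoboundaryIn E K ∧ E.Infinite ∧
      Eᶜ.Infinite ∧ ∀ (F : Set V) (L : Finset V), G.CoboundaryIn F L → F.Infinite → Fᶜ.Infinite →
        (symmDiff F E).Finite ∨ (symmDiff F Eᶜ).Finite := by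
  classical
  obtain ⟨e₁, e₂, hne, hend⟩ := Set.encard_eq_two.1 h2
  have he₁ : e₁ ∈ G.end := by rw [hend]; simp
  have he₂ : e₂ ∈ G.end := by rw [hend]; simp
  obtain ⟨K₀, hK₀⟩ := Function.ne_iff.1 hne
  obtain ⟨K, hK⟩ := ComponentCompl.exists_coboundaryIn (K := K₀.unop) (e₁ K₀)
  have hEi := infinite_supp_of_mem_end he₁ K₀
  have hEi' : (ComponentCompl.supp (e₁ K₀))ᶜ.Infinite := (infinite_supp_of_mem_end he₂ K₀).mono
    (Set.subset_compl_iff_disjoint_left.2 (ComponentCompl.pairwise_disjoint hK₀))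
  refine ⟨_, K, hK, hEi, hEi', fun F L hF hFi hFi' => ?_⟩
  set E := (e₁ K₀).supp
  -- Three disjoint infinite sets with finite coboundary would carry three distinct ends.
  have key (A B C : Set V) (hA : A.Infinite) (hB : B.Infinite) (hC : C.Infinite)
      (hAM : G.CoboundaryIn A (K ∪ L : Finset V)) (hBM : G.CoboundaryIn B (K ∪ L : Finset V))
      (hCM : G.CoboundaryIn C (K ∪ L : Finset V)) (hAB : Disjoint A B) (hAC : Disjoint A C)
      (hBC : Disjoint B C) : False := by
    obtain ⟨a, ha, ha'⟩ := exists_end_of_infinite hG hA hAM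
    obtain ⟨b, hb, hb'⟩ := exists_end_of_infinite hG hB hBM
    obtain ⟨c, hc, hc'⟩ := exists_end_of_infinite hG hC hCM
    have aux {x y : ∀ K, G.componentComplFunctor.obj K} {A B : Set V}
        (hx : ∀ M : Finset V, (K ∪ L) ⊆ M → (x (op M)).supp ⊆ A)
        (hy : ∀ M : Finset V, (K ∪ L) ⊆ M → (y (op M)).supp ⊆ B) (h : Disjoint A B) :
        x ≠ y := by
      rintro rfl
      obtain ⟨v, hv⟩ := ComponentCompl.nonempty (K := ((K ∪ L : Finset V) : Set V)) (x (op (K ∪ L)))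
      exact Set.disjoint_left.1 h (hx _ subset_rfl hv) (hy _ subset_rfl hv)
    have h1 := aux ha' hb' hAB
    have h2 := aux ha' hc' hAC
    have h3 := aux hb' hc' hBC
    rw [hend] at ha hb hc
    simp only [Set.mem_insert_iff, Set.mem_singleton_iff] at ha hb hc
    grind
  have hE' := hK.mono (L := (K ∪ L : Finset V)) (by simp)
  have hF' := hF.mono (L := (K ∪ L : Finset V)) (by simp)
  have dF (B C : Set V) : Disjoint (F ∩ B) (Fᶜ ∩ C) :=
    disjoint_compl_right.mono Set.inter_subset_left Set.inter_subset_left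
  have dE (B C : Set V) : Disjoint (B ∩ E) (C ∩ Eᶜ) :=
    disjoint_compl_right.mono Set.inter_subset_right Set.inter_subset_right
  have c₁ := hF'.inter hE'
  have c₂ := hF'.inter hE'.compl
  have c₃ := hF'.compl.inter hE'
  have c₄ := hF'.compl.inter hE'.compl
  by_contra! h
  rcases Set.three_infinite_of_symmDiff_infinite hEi hEi' hFi hFi' h.1 h.2 with
    ⟨a, b, c⟩ | ⟨a, b, c⟩ | ⟨a, b, c⟩ | ⟨a, b, c⟩
  · exact key _ _ _ a b c c₁ c₂ c₃ (dE _ _) (dF _ _) (dF _ _)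
  · exact key _ _ _ a b c c₁ c₂ c₄ (dE _ _) (dF _ _) (dF _ _)
  · exact key _ _ _ a b c c₁ c₃ c₄ (dF _ _) (dF _ _) (dE _ _)
  · exact key _ _ _ a b c c₂ c₃ c₄ (dF _ _) (dF _ _) (dE _ _)

end SimpleGraph

/-! ### Cayley graphs and translation -/

namespace SimpleGraph

variable {X : Type u} [Group X] {A : Set X}

theorem mulCayley_preconnected (hA : Subgroup.closure A = ⊤) : (mulCayley A).Preconnected := by
  have key (g : X) : ∀ u, (mulCayley A).Reachable u (u * g) := by
    have hg : g ∈ Subgroup.closure A := hA ▸ Subgroup.mem_top g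
    induction hg using Subgroup.closure_induction with
    | mem g hg =>
      intro u
      by_cases h : u = u * g
      · rw [← h]
      · exact Adj.reachable ((mulCayley_adj _ _ _).2 ⟨h, .inl (by simpa using hg)⟩)
    | one => intro u; rw [mul_one]
    | mul g h _ _ hg hh =>
      intro u
      rw [← mul_assoc]
      exact (hg u).trans (hh _)
    | inv g _ hg =>
      intro u
      simpa using (hg (u * g⁻¹)).symm
  intro u v
  simpa using key (u⁻¹ * v) u

theorem mulCayley_neighborSet_finite (hA : A.Finite) (u : X) :
    ((mulCayley A).neighborSet u).Finite := by
  refine ((hA.union hA.inv).smul_set (a := u)).subset fun v hv => ?_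
  rw [mem_neighborSet, mulCayley_adj] at hv
  rw [Set.mem_smul_set_iff_inv_smul_mem, smul_eq_mul]
  exact hv.2.imp_right fun h => by simpa using h

theorem CoboundaryIn.smul {E K : Set X} (h : (mulCayley A).CoboundaryIn E K) (g : X) :
    (mulCayley A).CoboundaryIn (g • E) (g • K) := by
  intro v w hvw hv hw
  rw [Set.mem_smul_set_iff_inv_smul_mem] at *
  rw [Set.mem_smul_set_iff_inv_smul_mem]
  exact h (mulCayley_adj_mul_iff_right.2 hvw) hv hw

theorem induce_smul_preconnected {K : Set X} (h : ((mulCayley A).induce K).Preconnected) (g : X) :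
    ((mulCayley A).induce (g • K)).Preconnected := by
  let f : (mulCayley A).induce K →g (mulCayley A).induce (g • K) :=
    { toFun := fun x => ⟨g • x.1, Set.smul_mem_smul_set x.2⟩
      map_rel' := fun {a b} hab => mulCayley_adj_mul_iff_right.2 hab }
  refine h.map f ?_
  rintro ⟨_, x, hx, rfl⟩
  exact ⟨⟨x, hx⟩, rfl⟩

end SimpleGraph

/-! ### Almost stabilizers and the shift homomorphism -/

section AlmostEqual

variable {α : Type*} {P Q R U : Set α}

/-- The difference between the numbers of elements of two sets that differ in finitely many
elements. -/
noncomputable def Set.relCard (P Q : Set α) : ℤ := (P \ Q).ncard - (Q \ P).ncard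

/-- Inside a common finite window the relative count is an honest difference of cardinalities, which
makes it additive. -/
theorem Set.relCard_eq (hU : U.Finite) (h : symmDiff P Q ⊆ U) :
    P.relCard Q = (P ∩ U).ncard - (Q ∩ U).ncard := by
  have key {P Q : Set α} (h : P \ Q ⊆ U) : (P ∩ U ∩ Q).ncard + (P \ Q).ncard = (P ∩ U).ncard := by
    rw [← Set.ncard_inter_add_ncard_sdiff_eq_ncard (P ∩ U) Q (hU.inter_of_right P)]
    congr 2
    ext x
    constructor
    · exact fun hx => ⟨⟨hx.1, h hx⟩, hx.2⟩
    · exact fun hx => ⟨hx.1.1, hx.2⟩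
  have h1 := key (Set.subset_union_left.trans h)
  have h2 := key (Set.subset_union_right.trans h)
  have h3 : P ∩ U ∩ Q = Q ∩ U ∩ P := by
    ext; simp; tauto
  rw [h3] at h1
  rw [relCard]
  omega

theorem Set.relCard_add (h : (symmDiff P Q).Finite) (h' : (symmDiff Q R).Finite) :
    P.relCard R = P.relCard Q + Q.relCard R := by
  have hU := h.union h'
  rw [relCard_eq hU Set.subset_union_left, relCard_eq hU Set.subset_union_right,
    relCard_eq hU (symmDiff_triangle P Q R)]
  ring

theorem Set.relCard_smul {G : Type*} [Group G] [MulAction G α] (g : G) (P Q : Set α) :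
    (g • P).relCard (g • Q) = P.relCard Q := by
  rw [relCard, relCard, ← Set.smul_set_sdiff, ← Set.smul_set_sdiff, Set.ncard_smul_set,
    Set.ncard_smul_set]

theorem Set.relCard_ne_zero (h : (symmDiff P Q).Finite) (h' : P ⊂ Q ∨ Q ⊂ P) :
    P.relCard Q ≠ 0 := by
  have hP : (P \ Q).Finite := h.subset Set.subset_union_left
  have hQ : (Q \ P).Finite := h.subset Set.subset_union_right
  rw [relCard]
  rcases h' with h' | h'
  · have := (Set.ncard_pos hQ).2 (Set.sdiff_nonempty.2 h'.2)
    rw [Set.sdiff_eq_empty.2 h'.1, Set.ncard_empty]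
    omega
  · have := (Set.ncard_pos hP).2 (Set.sdiff_nonempty.2 h'.2)
    rw [Set.sdiff_eq_empty.2 h'.1, Set.ncard_empty]
    omega

variable (G : Type*) [Group G] [MulAction G α] (E : Set α)

/-- The elements of `G` moving `E` to a set that differs from `E` in finitely many elements. -/
def almostStabilizer : Subgroup G where
  carrier := {g | (symmDiff E (g • E)).Finite}
  one_mem' := by simp
  mul_mem' {a b} ha hb := by
    refine (ha.union (hb.smul_set (a := a))).subset ?_
    rw [Set.smul_set_symmDiff, smul_smul]
    exact symmDiff_triangle _ _ _
  inv_mem' {a} ha := by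
    have := ha.smul_set (a := a⁻¹)
    rwa [Set.smul_set_symmDiff, inv_smul_smul, symmDiff_comm] at this

variable {G E} in
theorem mem_almostStabilizer {g : G} : g ∈ almostStabilizer G E ↔ (symmDiff E (g • E)).Finite :=
  Iff.rfl

/-- The net number of elements by which an element of the almost stabilizer of `E` shifts `E`. -/
noncomputable def almostStabilizerShift : almostStabilizer G E →* Multiplicative ℤ where
  toFun g := .ofAdd (E.relCard ((g : G) • E))
  map_one' := by simp [Set.relCard]
  map_mul' a b := by
    rw [← ofAdd_add, Subgroup.coe_mul, ← smul_smul, Set.relCard_add (Q := (a : G) • E) a.2,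
      Set.relCard_smul]
    rw [← Set.smul_set_symmDiff]
    exact b.2.smul_set

variable {G E} in
theorem finiteIndex_almostStabilizer (h : ∀ g : G, (symmDiff (g • E) E).Finite ∨
    (symmDiff (g • E) Eᶜ).Finite) : (almostStabilizer G E).FiniteIndex := by
  have key {a b : G} (ha : a ∉ almostStabilizer G E) (hb : b ∉ almostStabilizer G E) :
      a⁻¹ * b ∈ almostStabilizer G E := by
    rw [mem_almostStabilizer, symmDiff_comm] at ha hb
    have ha' := (h a).resolve_left ha
    have hb' := (h b).resolve_left hb
    rw [symmDiff_comm] at hb'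
    have := ((ha'.union hb').subset (symmDiff_triangle _ _ _)).smul_set (a := a⁻¹)
    rwa [Set.smul_set_symmDiff, inv_smul_smul, smul_smul] at this
  have : Finite (G ⧸ almostStabilizer G E) := by
    -- Two elements outside the almost stabilizer both send `E` almost to `Eᶜ`, so they share a
    -- coset: the index is at most two.
    refine Finite.of_injective (β := Prop)
      (Quotient.lift (· ∈ almostStabilizer G E) fun a b hab => ?_) ?_
    · have hab : a⁻¹ * b ∈ almostStabilizer G E := QuotientGroup.leftRel_apply.1 hab
      exact propext ⟨fun ha => by simpa using mul_mem ha hab,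
        fun hb => by simpa using mul_mem hb (inv_mem hab)⟩
    · intro a b hab
      induction a using QuotientGroup.induction_on with | _ a
      induction b using QuotientGroup.induction_on with | _ b
      have hab : (a ∈ almostStabilizer G E) = (b ∈ almostStabilizer G E) := hab
      rw [QuotientGroup.eq]
      by_cases ha : a ∈ almostStabilizer G E
      · exact mul_mem (inv_mem ha) (hab ▸ ha)
      · exact key ha (hab ▸ ha)
  exact Subgroup.finiteIndex_of_finite_quotient

end AlmostEqual

/-! ### Two-ended groups are virtually infinite cyclic -/

/-- `X` has an infinite cyclic subgroup of finite index. -/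
def IsVirtuallyInfiniteCyclic (X : Type*) [Group X] : Prop :=
  ∃ A : Subgroup X, A.FiniteIndex ∧ Nonempty (A ≃* Multiplicative ℤ)

theorem Subgroup.nonempty_zpowers_mulEquiv {X : Type*} [Group X] {x : X}
    (hx : Function.Injective fun n : ℤ => x ^ n) :
    Nonempty (Subgroup.zpowers x ≃* Multiplicative ℤ) := by
  have e := MonoidHom.ofInjective (f := zpowersHom X x) fun a b h => hx h
  have h : (zpowersHom X x).range = Subgroup.zpowers x := rfl
  exact ⟨(e.trans (MulEquiv.subgroupCongr h)).symm⟩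

theorem IsVirtuallyInfiniteCyclic.of_finite_ker {X : Type*} [Group X] [Infinite X]
    (c : X →* Multiplicative ℤ) (hc : (c.ker : Set X).Finite) : IsVirtuallyInfiniteCyclic X := by
  have hx : ∃ x, c x ≠ 1 := by
    by_contra! h
    refine Set.infinite_univ (hc.subset fun x _ => h x)
  obtain ⟨x, hx⟩ := hx
  have hx' : (c x).toAdd ≠ 0 := hx
  have hfib (a : Multiplicative ℤ) : (c ⁻¹' {a}).Finite := by
    rcases (c ⁻¹' {a}).eq_empty_or_nonempty with h | ⟨y, hy⟩
    · rw [h]; exact Set.finite_empty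
    · refine (hc.smul_set (a := y)).subset fun z hz => ?_
      rw [Set.mem_smul_set_iff_inv_smul_mem]
      simp_all [MonoidHom.mem_ker]
  let T : Set (Multiplicative ℤ) := Multiplicative.toAdd ⁻¹' Set.Ico 0 |(c x).toAdd|
  have hT : T.Finite := (Set.finite_Ico _ _).preimage Multiplicative.toAdd.injective.injOn
  have hcT : (c ⁻¹' T).Finite := hT.preimage' fun b _ => hfib b
  have : Finite (X ⧸ Subgroup.zpowers x) := by
    have := hcT.to_subtype
    refine Finite.of_surjective (fun y : c ⁻¹' T => (QuotientGroup.mk y.1 : X ⧸ Subgroup.zpowers x))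
      fun q => ?_
    induction q using QuotientGroup.induction_on with | _ y
    refine ⟨⟨y * x ^ (-((c y).toAdd / (c x).toAdd)), ?_⟩, ?_⟩
    · have h : (c (y * x ^ (-((c y).toAdd / (c x).toAdd)))).toAdd = (c y).toAdd % (c x).toAdd := by
        simp [Int.emod_def, mul_comm, sub_eq_add_neg]
      refine Set.mem_preimage.2 (Set.mem_preimage.2 ?_)
      rw [h]
      exact ⟨Int.emod_nonneg _ hx', Int.emod_lt_abs _ hx'⟩
    · rw [QuotientGroup.eq]
      simp
  refine ⟨_, Subgroup.finiteIndex_of_finite_quotient, Subgroup.nonempty_zpowers_mulEquiv (x := x) ?_⟩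
  intro m n hmn
  have : m * (c x).toAdd = n * (c x).toAdd := by
    have := congrArg (fun y => (c y).toAdd) hmn
    simpa using this
  exact mul_right_cancel₀ hx' this

theorem IsVirtuallyInfiniteCyclic.of_subgroup {X : Type*} [Group X] {H : Subgroup X}
    [H.FiniteIndex] (h : IsVirtuallyInfiniteCyclic H) : IsVirtuallyInfiniteCyclic X := by
  obtain ⟨A, hA, ⟨e⟩⟩ := h
  refine ⟨A.map H.subtype, ⟨?_⟩, ⟨(A.equivMapOfInjective _ H.subtype_injective).symm.trans e⟩⟩
  rw [Subgroup.index_map_subtype]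
  exact mul_ne_zero hA.index_ne_zero Subgroup.FiniteIndex.index_ne_zero

/-- A two-ended group has an infinite cyclic subgroup of finite index. -/
theorem IsTwoEnded.isVirtuallyInfiniteCyclic {X : Type u} [Group X] (h : IsTwoEnded X) :
    IsVirtuallyInfiniteCyclic X := by
  obtain ⟨A, hAf, hA, h2⟩ := h
  have hG := SimpleGraph.mulCayley_preconnected hA
  let : (SimpleGraph.mulCayley A).LocallyFinite := fun u =>
    (SimpleGraph.mulCayley_neighborSet_finite hAf u).fintype
  obtain ⟨E, K₀, hE, hEi, hEi', hF⟩ := SimpleGraph.exists_infinite_of_two_ends hG h2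
  have hK₀ : K₀.Nonempty := by
    obtain ⟨⟨x, hx⟩, -⟩ := hE.inter_nonempty hG hEi.nonempty hEi'.nonempty
    exact ⟨x, hx.2⟩
  -- Nesting of `E` and `g • E` requires a connected set around the coboundary.
  obtain ⟨K, hK₀K, hK⟩ := SimpleGraph.extend_finset_to_connected hG hK₀
  replace hE := hE.mono (Finset.coe_subset.2 hK₀K)
  have hH : (almostStabilizer X E).FiniteIndex := finiteIndex_almostStabilizer fun g => by
    classical
    refine hF (g • E) (K.image (g * ·)) ?_ hEi.smul_set ?_
    · have := hE.smul g
      rw [Finset.coe_image]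
      exact this
    · rw [← Set.smul_set_compl]
      exact hEi'.smul_set
  have : Infinite X := Set.infinite_univ_iff.1 (hEi.mono (Set.subset_univ _))
  have : Infinite (almostStabilizer X E) := by
    by_contra h
    rw [not_infinite_iff_finite] at h
    refine mul_ne_zero (Nat.card_pos (α := almostStabilizer X E)).ne' hH.index_ne_zero ?_
    rw [Subgroup.card_mul_index, Nat.card_eq_zero_of_infinite]
  refine IsVirtuallyInfiniteCyclic.of_subgroup (H := almostStabilizer X E)
    (.of_finite_ker (almostStabilizerShift X E) ?_)
  refine Set.Finite.of_finite_image (f := Subtype.val)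
    -- If `g ∉ K * K⁻¹`, then `K` and `g • K` are disjoint, so `E` and `g • E` are properly nested
    -- and the shift is nonzero.
    ((K.finite_toSet.mul K.finite_toSet.inv).subset ?_) Subtype.val_injective.injOn
  rintro _ ⟨⟨g, hgH⟩, hg, rfl⟩
  by_contra hgK
  have hd : Disjoint (K : Set X) (g • (K : Set X)) := by
    rw [Set.disjoint_left]
    rintro _ hx ⟨y, hy, rfl⟩
    exact hgK ⟨_, hx, y⁻¹, by simpa using hy, by simp⟩
  refine Set.relCard_ne_zero hgH ?_ (congrArg Multiplicative.toAdd hg)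
  have := hE.ssubset_or_ssubset (hE.smul g) hG hK.preconnected
    (SimpleGraph.induce_smul_preconnected hK.preconnected g) hd hEi hEi'
    (hgH.subset Set.subset_union_left) (hgH.subset Set.subset_union_right)
  exact this.symm

/-- Infinite cyclic groups have infinite cyclic subgroups of every positive index. -/
theorem exists_subgroup_multiplicative_int {m : ℕ} (hm : m ≠ 0) :
    ∃ B : Subgroup (Multiplicative ℤ), B.index = m ∧ Nonempty (B ≃* Multiplicative ℤ) := by
  refine ⟨Subgroup.zpowers (Multiplicative.ofAdd (m : ℤ)), ?_,
    Subgroup.nonempty_zpowers_mulEquiv fun a b h => ?_⟩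
  · have h : Subgroup.zpowers (Multiplicative.ofAdd (m : ℤ)) =
        (AddSubgroup.zmultiples (m : ℤ)).toSubgroup := rfl
    rw [h, AddSubgroup.index_toSubgroup, Int.index_zmultiples, Int.natAbs_natCast]
  · have h : a * (m : ℤ) = b * m := by
      simpa using congrArg Multiplicative.toAdd h
    exact mul_right_cancel₀ (Int.natCast_ne_zero.2 hm) h

theorem GraphProduct.abstractlyCommensurable_of_isVirtuallyInfiniteCyclic {S : Type u} [Finite S]
    (Γ : SimpleGraph S) (X : S → Type v) [∀ s, Group (X s)]
    (h : ∀ s, IsVirtuallyInfiniteCyclic (X s)) :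
    AbstractlyCommensurable (GraphProduct Γ X) (GraphProduct Γ fun _ => Multiplicative ℤ) := by
  refine GraphProduct.abstractlyCommensurable Γ fun s => ?_
  obtain ⟨A, hA, ⟨e⟩⟩ := h s
  obtain ⟨B, hB, ⟨e'⟩⟩ := exists_subgroup_multiplicative_int hA.index_ne_zero
  exact ⟨A, B, hA.index_ne_zero, hB.symm, ⟨e.trans e'.symm⟩⟩

namespace AbstractlyCommensurable

variable {G H K : Type*} [Group G] [Group H] [Group K]

theorem symm (h : AbstractlyCommensurable G H) : AbstractlyCommensurable H G := by
  obtain ⟨A, B, hA, hB, ⟨e⟩⟩ := h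
  exact ⟨B, A, hB, hA, ⟨e.symm⟩⟩

theorem trans_mulEquiv (h : AbstractlyCommensurable G H) (e : H ≃* K) :
    AbstractlyCommensurable G K := by
  obtain ⟨A, B, hA, hB, ⟨f⟩⟩ := h
  refine ⟨A, B.map (e : H →* K), hA, ⟨?_⟩, ⟨f.trans (B.equivMapOfInjective _ e.injective)⟩⟩
  rw [Subgroup.index_map_equiv]
  exact hB.index_ne_zero

end AbstractlyCommensurable

/-! ### Right-angled Artin groups as graph products of infinite cyclic groups -/

section RAAG

variable {S : Type u} (Γ : SimpleGraph S)

theorem RAAG.of_mul_of_comm {s t : S} (hst : Γ.Adj s t) :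
    (PresentedGroup.of s : RAAG Γ) * PresentedGroup.of t =
      PresentedGroup.of t * PresentedGroup.of s := by
  have h : PresentedGroup.mk (raagRels Γ)
      ((FreeGroup.of s)⁻¹ * (FreeGroup.of t)⁻¹ * FreeGroup.of s * FreeGroup.of t) = 1 :=
    (QuotientGroup.eq_one_iff _).2 (Subgroup.subset_normalClosure ⟨s, t, hst, rfl⟩)
  have h' : (PresentedGroup.of s : RAAG Γ)⁻¹ * (PresentedGroup.of t)⁻¹ * PresentedGroup.of s *
    PresentedGroup.of t = 1 := h
  rw [mul_assoc, ← mul_inv_rev, inv_mul_eq_one] at h'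
  exact h'.symm

theorem graphProductInt_relations : ∀ r ∈ raagRels Γ, FreeGroup.lift
    (fun s => (GraphProduct.of s (Multiplicative.ofAdd 1) :
      GraphProduct Γ fun _ => Multiplicative ℤ)) r = 1 := by
  rintro _ ⟨s, t, hst, rfl⟩
  simp only [map_mul, map_inv, FreeGroup.lift_apply_of]
  rw [mul_assoc, GraphProduct.of_mul_of_comm hst, ← mul_inv_rev, inv_mul_cancel]

/-- The homomorphism to the right-angled Artin group sending `1 : ℤ` to a standard generator. -/
def graphProductIntToRAAG : GraphProduct Γ (fun _ => Multiplicative ℤ) →* RAAG Γ :=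
  GraphProduct.lift (fun s => zpowersHom (RAAG Γ) (PresentedGroup.of s)) fun _ _ hst _ _ =>
    (Commute.zpow_zpow (RAAG.of_mul_of_comm Γ hst) _ _).eq

theorem graphProductIntToRAAG_of (s : S) (x : Multiplicative ℤ) :
    graphProductIntToRAAG Γ (GraphProduct.of s x) = PresentedGroup.of s ^ x.toAdd :=
  GraphProduct.lift_of (fun s => zpowersHom (RAAG Γ) (PresentedGroup.of s)) _ s x

/-- The right-angled Artin group as a graph product of infinite cyclic groups. -/
def graphProductIntEquivRAAG : GraphProduct Γ (fun _ => Multiplicative ℤ) ≃* RAAG Γ :=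
  MonoidHom.toMulEquiv (graphProductIntToRAAG Γ)
    (PresentedGroup.toGroup (graphProductInt_relations Γ))
    (GraphProduct.hom_ext fun s x => by
      rw [MonoidHom.comp_apply, graphProductIntToRAAG_of, map_zpow, PresentedGroup.toGroup.of,
        ← map_zpow, ← ofAdd_zsmul]
      simp)
    (PresentedGroup.ext fun s => by
      rw [MonoidHom.comp_apply, PresentedGroup.toGroup.of, graphProductIntToRAAG_of]
      simp)

end RAAG

/-! ### The infinite dihedral group -/

section InfiniteDihedral

open DihedralGroup

/-- The homomorphism from the infinite dihedral group given by a pair of involutions. -/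
def infiniteDihedralLift {N : Type*} [Group N] (a b : N) (ha : a * a = 1) (hb : b * b = 1) :
    DihedralGroup 0 →* N where
  toFun
    -- `ZMod 0` unfolds to `ℤ`; `a`, `b` are the images of `sr 0`, `sr 1`, whose product is `r 1`.
    | r i => (a * b) ^ (show ℤ from i)
    | sr i => a * (a * b) ^ (show ℤ from i)
  map_one' := zpow_zero (a * b)
  map_mul' := by
    have ha' : a⁻¹ = a := inv_eq_of_mul_eq_one_right ha
    have hb' : b⁻¹ = b := inv_eq_of_mul_eq_one_right hb
    have hconj (i : ℤ) : (a * b) ^ i * a = a * (a * b) ^ (-i) := by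
      have h1 : a * (a * b) * a⁻¹ = (a * b)⁻¹ := by
        rw [mul_inv_rev, ha', hb', ← mul_assoc, ha, one_mul]
      have h2 : a * (a * b) ^ (-i) * a⁻¹ = (a * b) ^ i := by
        rw [← conj_zpow, h1, inv_zpow', neg_neg]
      rw [← h2, inv_mul_cancel_right]
    rintro (i | i) (j | j)
    · exact zpow_add (a * b) (show ℤ from i) (show ℤ from j)
    · change a * (a * b) ^ ((show ℤ from j) - (show ℤ from i)) = _
      rw [← mul_assoc, hconj, mul_assoc, ← zpow_add, sub_eq_neg_add]
    · change a * (a * b) ^ ((show ℤ from i) + (show ℤ from j)) = _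
      rw [zpow_add, mul_assoc]
    · change (a * b) ^ ((show ℤ from j) - (show ℤ from i)) = _
      rw [mul_assoc, ← mul_assoc _ a, hconj, ← mul_assoc, ← mul_assoc, ha, one_mul, ← zpow_add,
        sub_eq_neg_add]

variable {N : Type*} [Group N] (a b : N) (ha : a * a = 1) (hb : b * b = 1)

theorem infiniteDihedralLift_sr_zero : infiniteDihedralLift a b ha hb (sr 0) = a := by
  change a * (a * b) ^ (0 : ℤ) = a
  simp

theorem infiniteDihedralLift_sr_one : infiniteDihedralLift a b ha hb (sr 1) = b := by
  change a * (a * b) ^ (1 : ℤ) = b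
  rw [zpow_one, ← mul_assoc, ha, one_mul]

theorem infiniteDihedral_mem_of_generators {H : Subgroup (DihedralGroup 0)} (h0 : sr 0 ∈ H)
    (h1 : sr 1 ∈ H) (x : DihedralGroup 0) : x ∈ H := by
  have hr (i : ZMod 0) : r i ∈ H := by
    have h : r 1 ∈ H := by simpa using mul_mem h0 h1
    have := zpow_mem h (show ℤ from i)
    rwa [r_one_zpow] at this
  rcases x with i | i
  · exact hr i
  · simpa using mul_mem h0 (hr i)

theorem infiniteDihedral_hom_ext {f g : DihedralGroup 0 →* N} (h0 : f (sr 0) = g (sr 0))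
    (h1 : f (sr 1) = g (sr 1)) (x : DihedralGroup 0) : f x = g x :=
  infiniteDihedral_mem_of_generators (H := f.eqLocus g) h0 h1 x

theorem infiniteDihedral_commute {f : DihedralGroup 0 →* N} {z : N} (h0 : Commute (f (sr 0)) z)
    (h1 : Commute (f (sr 1)) z) (x : DihedralGroup 0) : Commute (f x) z :=
  (Subgroup.mem_centralizer_singleton_iff.1 (infiniteDihedral_mem_of_generators
    (H := (Subgroup.centralizer {z}).comap f) (Subgroup.mem_centralizer_singleton_iff.2 h0)
    (Subgroup.mem_centralizer_singleton_iff.2 h1) x : f x ∈ Subgroup.centralizer {z}))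

theorem r_one_zpow_zmod (i : ZMod 0) : (r 1 : DihedralGroup 0) ^ (show ℤ from i) = r i :=
  r_one_zpow (n := 0) _

theorem infiniteDihedral_isVirtuallyInfiniteCyclic :
    IsVirtuallyInfiniteCyclic (DihedralGroup 0) := by
  refine ⟨Subgroup.zpowers (r 1), ?_, Subgroup.nonempty_zpowers_mulEquiv fun m n h => ?_⟩
  · have : Finite (DihedralGroup 0 ⧸ Subgroup.zpowers (r 1 : DihedralGroup 0)) := by
      refine Finite.of_surjective (α := Bool)
        (fun b => QuotientGroup.mk (if b then 1 else sr 0)) fun q => ?_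
      induction q using QuotientGroup.induction_on with | _ x
      rcases x with i | i
      · refine ⟨true, QuotientGroup.eq.2 ⟨(show ℤ from i), ?_⟩⟩
        simp [r_one_zpow_zmod]
      · refine ⟨false, QuotientGroup.eq.2 ⟨(show ℤ from i), ?_⟩⟩
        simp [r_one_zpow_zmod]
    exact Subgroup.finiteIndex_of_finite_quotient
  · simp only [r_one_zpow] at h
    exact r.inj h

end InfiniteDihedral

/-! ### Graph products of infinite dihedral groups as right-angled Coxeter groups -/

section Coxeter

variable {S : Type u} (Γ : SimpleGraph S)

open Classical in
/-- The right-angled Coxeter matrix with two generators for each vertex of `Γ`, where generators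
commute if they belong to adjacent vertices. -/
noncomputable def doubleCoxeterMatrix : CoxeterMatrix (S × Bool) where
  M i j := if i = j then 1 else if Γ.Adj i.1 j.1 then 2 else 0
  isSymm := by
    ext i j
    change (if j = i then 1 else if Γ.Adj j.1 i.1 then 2 else 0) =
      if i = j then 1 else if Γ.Adj i.1 j.1 then 2 else 0
    rw [Γ.adj_comm]
    simp only [eq_comm]
  diagonal i := if_pos rfl
  off_diagonal i j h := by
    rw [if_neg h]
    split_ifs <;> simp

open Classical in
theorem doubleCoxeterMatrix_apply (i j : S × Bool) :
    doubleCoxeterMatrix Γ i j = if i = j then 1 else if Γ.Adj i.1 j.1 then 2 else 0 := rfl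

theorem doubleCoxeterMatrix_of_adj {s t : S} (h : Γ.Adj s t) (a b : Bool) :
    doubleCoxeterMatrix Γ (s, a) (t, b) = 2 := by
  rw [doubleCoxeterMatrix_apply, if_neg fun e => h.ne (congrArg Prod.fst e), if_pos h]

theorem isRightAngled_doubleCoxeterMatrix : IsRightAngled (doubleCoxeterMatrix Γ) := by
  intro i j h
  rw [doubleCoxeterMatrix_apply, if_neg h]
  split_ifs <;> simp

theorem doubleCoxeterMatrix_isLiftable {N : Type*} [Group N] (f : S × Bool → N)
    (h : ∀ i, f i * f i = 1)
    (hc : ∀ s t, Γ.Adj s t → ∀ a b, f (s, a) * f (t, b) = f (t, b) * f (s, a)) :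
    (doubleCoxeterMatrix Γ).IsLiftable f := by
  intro i j
  rw [doubleCoxeterMatrix_apply]
  split_ifs with h1 h2
  · rw [h1, pow_one, h]
  · have h3 : f i * f j = f j * f i := hc _ _ h2 _ _
    rw [pow_two, mul_assoc, ← mul_assoc (f j), ← h3, mul_assoc, h, mul_one, h]
  · rw [pow_zero]

theorem doubleCoxeterMatrix_simple_mul_comm {s t : S} (h : Γ.Adj s t) (a b : Bool) :
    (doubleCoxeterMatrix Γ).simple (s, a) * (doubleCoxeterMatrix Γ).simple (t, b) =
      (doubleCoxeterMatrix Γ).simple (t, b) * (doubleCoxeterMatrix Γ).simple (s, a) := by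
  have h1 := (doubleCoxeterMatrix Γ).toCoxeterSystem.simple_mul_simple_pow (s, a) (t, b)
  have h2 := (doubleCoxeterMatrix Γ).toCoxeterSystem.inv_simple
  rw [doubleCoxeterMatrix_of_adj Γ h, pow_two, mul_eq_one_iff_eq_inv, mul_inv_rev, h2, h2] at h1
  exact h1

/-- The homomorphism from the infinite dihedral group to the Coxeter group given by the two
generators at a vertex. -/
noncomputable def dihedralToCoxeter (s : S) : DihedralGroup 0 →* (doubleCoxeterMatrix Γ).Group :=
  infiniteDihedralLift
    ((doubleCoxeterMatrix Γ).simple (s, false)) ((doubleCoxeterMatrix Γ).simple (s, true))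
    ((doubleCoxeterMatrix Γ).toCoxeterSystem.simple_mul_simple_self _)
    ((doubleCoxeterMatrix Γ).toCoxeterSystem.simple_mul_simple_self _)

theorem dihedralToCoxeter_sr (s : S) (b : Bool) :
    dihedralToCoxeter Γ s (DihedralGroup.sr (if b then 1 else 0)) =
      (doubleCoxeterMatrix Γ).simple (s, b) := by
  cases b
  · exact infiniteDihedralLift_sr_zero _ _ _ _
  · exact infiniteDihedralLift_sr_one _ _ _ _

theorem dihedralToCoxeter_mul_comm {s t : S} (h : Γ.Adj s t) (x y : DihedralGroup 0) :
    dihedralToCoxeter Γ s x * dihedralToCoxeter Γ t y =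
      dihedralToCoxeter Γ t y * dihedralToCoxeter Γ s x := by
  have key (a b : Bool) : Commute
      (dihedralToCoxeter Γ s (DihedralGroup.sr (if a then 1 else 0)))
      (dihedralToCoxeter Γ t (DihedralGroup.sr (if b then 1 else 0))) := by
    rw [dihedralToCoxeter_sr, dihedralToCoxeter_sr]
    exact doubleCoxeterMatrix_simple_mul_comm Γ h a b
  exact infiniteDihedral_commute
    (infiniteDihedral_commute (key false false).symm (key false true).symm y).symm
    (infiniteDihedral_commute (key true false).symm (key true true).symm y).symm x

/-- The homomorphism from the Coxeter group to the graph product of infinite dihedral groups. -/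
noncomputable def coxeterToGraphProductDihedral :
    (doubleCoxeterMatrix Γ).Group →* GraphProduct Γ fun _ => DihedralGroup 0 :=
  (doubleCoxeterMatrix Γ).toCoxeterSystem.lift
    ⟨fun i => GraphProduct.of i.1 (DihedralGroup.sr (if i.2 then 1 else 0)),
      doubleCoxeterMatrix_isLiftable Γ _
        (fun i => by rw [← map_mul, DihedralGroup.sr_mul_self, map_one])
        (fun s t h a b => GraphProduct.of_mul_of_comm h _ _)⟩

theorem coxeterToGraphProductDihedral_simple (i : S × Bool) :
    coxeterToGraphProductDihedral Γ ((doubleCoxeterMatrix Γ).simple i) =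
      GraphProduct.of i.1 (DihedralGroup.sr (if i.2 then 1 else 0)) :=
  (doubleCoxeterMatrix Γ).toCoxeterSystem.lift_apply_simple _ i

theorem coxeterToGraphProductDihedral_dihedralToCoxeter (s : S) (x : DihedralGroup 0) :
    coxeterToGraphProductDihedral Γ (dihedralToCoxeter Γ s x) = GraphProduct.of s x := by
  have key (b : Bool) : coxeterToGraphProductDihedral Γ
      (dihedralToCoxeter Γ s (DihedralGroup.sr (if b then 1 else 0))) =
        GraphProduct.of s (DihedralGroup.sr (if b then 1 else 0)) := by
    rw [dihedralToCoxeter_sr, coxeterToGraphProductDihedral_simple]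
  exact infiniteDihedral_hom_ext
    (f := (coxeterToGraphProductDihedral Γ).comp (dihedralToCoxeter Γ s))
    (g := GraphProduct.of (X := fun _ => DihedralGroup 0) s) (key false) (key true) x

/-- The graph product of infinite dihedral groups as a right-angled Coxeter group. -/
noncomputable def graphProductDihedralEquivCoxeter :
    GraphProduct Γ (fun _ => DihedralGroup 0) ≃* (doubleCoxeterMatrix Γ).Group :=
  MonoidHom.toMulEquiv
    (GraphProduct.lift (dihedralToCoxeter Γ) fun _ _ h => dihedralToCoxeter_mul_comm Γ h)
    (coxeterToGraphProductDihedral Γ)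
    (GraphProduct.hom_ext fun s x => by
      rw [MonoidHom.comp_apply, GraphProduct.lift_of,
        coxeterToGraphProductDihedral_dihedralToCoxeter, MonoidHom.id_apply])
    ((doubleCoxeterMatrix Γ).toCoxeterSystem.ext_simple fun i => by
      rw [MonoidHom.comp_apply, CoxeterMatrix.toCoxeterSystem_simple,
        coxeterToGraphProductDihedral_simple, GraphProduct.lift_of, dihedralToCoxeter_sr,
        MonoidHom.id_apply])

end Coxeter

theorem proposition5p4 {S : Type u} [Finite S] (Γ : SimpleGraph S) :
    (∀ (X : S → Type v) [∀ s, Group (X s)], (∀ s, IsTwoEnded (X s)) →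
      AbstractlyCommensurable (GraphProduct Γ X) (RAAG Γ)) ∧
    (∃ (T : Type u) (_ : Finite T) (M : CoxeterMatrix T),
      IsRightAngled M ∧ AbstractlyCommensurable (RAAG Γ) M.Group) := by
  refine ⟨fun X _ hX => ?_, S × Bool, inferInstance, doubleCoxeterMatrix Γ,
    isRightAngled_doubleCoxeterMatrix Γ, ?_⟩
  · exact (GraphProduct.abstractlyCommensurable_of_isVirtuallyInfiniteCyclic Γ X
      fun s => (hX s).isVirtuallyInfiniteCyclic).trans_mulEquiv (graphProductIntEquivRAAG Γ)
  -- Here every vertex group is infinite dihedral.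
  · exact ((GraphProduct.abstractlyCommensurable_of_isVirtuallyInfiniteCyclic Γ _
      fun _ => infiniteDihedral_isVirtuallyInfiniteCyclic).trans_mulEquiv
        (graphProductIntEquivRAAG Γ)).symm.trans_mulEquiv (graphProductDihedralEquivCoxeter Γ)
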